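/- Asymptotic efficiency of split conformal prediction intervals for $\beta$-mixing Markov chains. Setting. Let $K$ be a Markov kernel on $\mathcal X\times\mathbb R$ with a stationary probability law $\pi$, and let $Z_{-N},Z_{1-N},\dots,Z_0,Z_1,\dots$, with $Z_i=(X_i,Y_i)$, be a time-homogeneous Markov chain with kernel $K$ and initial law $\nu_0$ (the same $\nu_0$ for every $N$). The training sample is $D_{\mathrm{tr}}=(Z_{1-N},\dots,Z_0)$, the calibration sample is $(Z_1,\dots,Z_n)$, and the test point is $Z_{n+1}$. Let $\hat\mu_N:\mathcal X\to\mathbb R$ be a function obtained (jointly measurably) from $D_{\mathrm{tr}}$, let $\mu:\mathcal X\to\mathbb R$ be the measurable regression function, and let $0<\alpha<1$. Let $\hat q_{\alpha,n}$ be the $\lceil (n+1)(1-\alpha)\rceil$-th smallest of the scores $|Y_i-\hat\mu_N(X_i)|$, $1\le i\le n$ ($+\infty$ if $\lceil (n+1)(1-\alpha)\rceil>n$), and let $q_\alpha$ be the $(1-\alpha)$-quantile of $|Y-\mu(X)|$ under $(X,Y)\sim\pi$. Assume that under $\pi$ the variable $|Y-\mu(X)|$ has a density that is bounded below by some $\kappa>0$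 on a neighbourhood of $q_\alpha$. Write $\|P-Q\|_{TV}=\sup_A|P(A)-Q(A)|$, and for a process $(W_k)_{k\ge 0}$ let $\beta(a)$ be the supremum over $t\ge1$ of the total variation distance between the joint law of $(W_1,\dots,W_t)$ and $(W_{t+a},W_{t+a+1},\dots)$ and the product of their laws. Assume that the chain, started from $\nu_0$ (with $W_k=Z_{k-N}$), is $\beta$-mixing, $\beta(a)\to0$ as $a\to\infty$, and that $\|\nu_0K^k-\pi\|_{TV}\to0$ as $k\to\infty$. Assume that $\hat\mu_N$ is consistent in at least one of the following two senses: (a) there are sequences $c_N\to0$ and $d_N\to0$ with $\mathbb P(\|\hat\mu_N-\mu\|_\infty\le c_N)\ge 1-d_N$ for all $N$; (b) $\Delta_N=\mathbb E[(\hat\mu_N(X)-\mu(X))^2]\to0$ as $N\to\infty$, where $(X,Y)\sim\pi$ is independent of $D_{\mathrm{tr}}$. Conclusion. For every $\varepsilon>0$, the three probabilities $$\mathbb P\big(|\hat q_{\alpha,n}-q_\alpha|>\varepsilon\big),\qquad \mathbb P\big(|\hat\mu_N(X_{n+1})-\mu(X_{n+1})|>\varepsilon\big),\qquad \mathbb P\big(\mathrm{Leb}(C\,\triangle\,C^\star)>\varepsilon\big),$$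 where $C=[\hat\mu_N(X_{n+1})-\hat q_{\alpha,n},\ \hat\mu_N(X_{n+1})+\hat q_{\alpha,n}]$ is the conformal interval and $C^\star=[\mu(X_{n+1})-q_\alpha,\ \mu(X_{n+1})+q_\alpha]$ is the oracle interval, tend to $0$ as $n,N\to\infty$, whatever the order of the limits: jointly as $(n,N)\to(\infty,\infty)$, and also $\lim_{N\to\infty}\limsup_{n\to\infty}=0$ and $\lim_{n\to\infty}\limsup_{N\to\infty}=0$. Restart version. The same conclusion holds if calibration sample and test point $(Z_1,\dots,Z_{n+1})$ come instead from a chain $(Z_k)_{k\ge0}$ with the same kernel $K$ and some initial law $\nu_1$ that is independent of the training chain, provided that this chain is $\beta$-mixing and $\|\nu_1K^k-\pi\|_{TV}\to0$; then the training chain itself need neither be $\beta$-mixing nor converge. -/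

import Mathlib

open MeasureTheory ProbabilityTheory Filter Topology
open scoped ENNReal

noncomputable section

namespace ConformalMarkov

/-- Total variation distance `sup_A |P(A) - Q(A)|` of two (probability) measures. -/
def tv {S : Type*} [MeasurableSpace S] (P Q : Measure S) : ℝ≥0∞ :=
  ⨆ (A : Set S) (_ : MeasurableSet A), ENNReal.ofReal |P.real A - Q.real A|

/-- `W = (W 0, W 1, …)` is a time-homogeneous Markov chain on the probability space `(Ω, Pr)` with
transition kernel `K` and initial law `ν`: given `W 0, …, W k`, the law of `W (k+1)` is
`K (W k)`. -/
structure IsMarkovChain {Ω S : Type*} [MeasurableSpace Ω] [MeasurableSpace S]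
    (Pr : Measure Ω) (W : ℕ → Ω → S) (K : Kernel S S) (ν : Measure S) : Prop where
  measurable : ∀ k, Measurable (W k)
  map_zero : Pr.map (W 0) = ν
  condProb_succ : ∀ (k : ℕ) (A : Set S), MeasurableSet A →
    Pr⟦W (k + 1) ⁻¹' A | ⨆ i ≤ k, MeasurableSpace.comap (W i) inferInstance⟧
      =ᵐ[Pr] fun ω => (K (W k ω)).real A

/-- The chain with kernel `K` started from `ν` converges to `π`:
`‖ν K^k - π‖_TV → 0` as `k → ∞`. -/
def ConvergesInTV {S : Type*} [MeasurableSpace S] (K : Kernel S S) (ν π : Measure S) : Prop :=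
  Tendsto (fun k : ℕ => tv ((K ^ k) ∘ₘ ν) π) atTop (𝓝 0)

/-- The first `t` observations `(W 1, …, W t)`; the initial state `W 0` is not observed. -/
def past {Ω S : Type*} (W : ℕ → Ω → S) (t : ℕ) (ω : Ω) : Fin t → S := fun i => W (i + 1) ω

/-- The future `(W s, W (s+1), …)` from time `s` on. -/
def future {Ω S : Type*} (W : ℕ → Ω → S) (s : ℕ) (ω : Ω) : ℕ → S := fun k => W (s + k) ω

/-- The `β`-mixing coefficients: `β(a)` is the supremum over `t ≥ 1` of the total variation
distance between the joint law of `(W 1, …, W t)` and `(W (t+a), W (t+a+1), …)` and the product of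
their laws. -/
def betaCoeff {Ω S : Type*} [MeasurableSpace Ω] [MeasurableSpace S]
    (Pr : Measure Ω) (W : ℕ → Ω → S) (a : ℕ) : ℝ≥0∞ :=
  ⨆ (t : ℕ) (_ : 1 ≤ t),
    tv (Pr.map fun ω => (past W t ω, future W (t + a) ω))
      ((Pr.map (past W t)).prod (Pr.map (future W (t + a))))

/-- The process is `β`-mixing: `β(a) → 0` as `a → ∞`. -/
def IsBetaMixing {Ω S : Type*} [MeasurableSpace Ω] [MeasurableSpace S]
    (Pr : Measure Ω) (W : ℕ → Ω → S) : Prop :=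
  Tendsto (betaCoeff Pr W) atTop (𝓝 0)

/-- The law of `|Y - μ(X)|` when `(X, Y) ∼ π`. -/
def residualLaw {X : Type*} [MeasurableSpace X] (π : Measure (X × ℝ)) (μ : X → ℝ) : Measure ℝ :=
  π.map fun z => |z.2 - μ z.1|

/-- The quantile of order `p` of a law `m` on the real line. -/
def quantile (m : Measure ℝ) (p : ℝ) : ℝ := sInf {q : ℝ | p ≤ cdf m q}

/-- The law `m` has a density with respect to Lebesgue measure which is bounded below by some
`κ > 0` on a neighbourhood of `q`. -/
def HasDensityBoundedBelowNear (m : Measure ℝ) (q : ℝ) : Prop :=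
  ∃ f : ℝ → ℝ≥0∞, Measurable f ∧ m = volume.withDensity f ∧
    ∃ κ > (0 : ℝ), ∃ η > (0 : ℝ), ∀ t : ℝ, |t - q| < η → ENNReal.ofReal κ ≤ f t

/-- The split conformal quantile of the scores `s 0, …, s (n-1)`: their
`⌈(n+1)(1-α)⌉`-th smallest value, and `⊤` if `n < ⌈(n+1)(1-α)⌉`. -/
def empQuantile (α : ℝ) {n : ℕ} (s : Fin n → ℝ) : EReal :=
  sInf {q : EReal | ⌈((n : ℝ) + 1) * (1 - α)⌉₊ ≤ Nat.card {i : Fin n // (s i : EReal) ≤ q}}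

/-- The split conformal quantile for the score `|y - m(x)|` on calibration data `cal`. -/
def conformalQuantile {X : Type*} (α : ℝ) (m : X → ℝ) {n : ℕ} (cal : Fin n → X × ℝ) : EReal :=
  empQuantile α fun i => |(cal i).2 - m (cal i).1|

/-- The interval with centre `c` and radius `r` (the whole line if `r = ⊤`). -/
def interval (c : ℝ) (r : EReal) : Set ℝ := {y : ℝ | ((|y - c| : ℝ) : EReal) ≤ r}

/-- Consistency of the regression estimator. `train N` is the training sample of size `N` and
`μhat N D` is the function that the learning algorithm returns on the training sample `D`.
Either `Pr(‖μ̂_N - μ‖_∞ ≤ c_N) ≥ 1 - d_N` for all `N` with some `c_N → 0`, `d_N → 0`, or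
`Δ_N = E[(μ̂_N(X) - μ(X))^2] → 0`, where `(X, Y) ∼ π` is independent of the training sample. -/
def Consistent {Ω X : Type*} [MeasurableSpace Ω] [MeasurableSpace X] (Pr : Measure Ω)
    (π : Measure (X × ℝ)) (train : (N : ℕ) → Ω → Fin N → X × ℝ)
    (μhat : (N : ℕ) → (Fin N → X × ℝ) → X → ℝ) (μ : X → ℝ) : Prop :=
  (∃ c d : ℕ → ℝ, Tendsto c atTop (𝓝 0) ∧ Tendsto d atTop (𝓝 0) ∧
    ∀ N, Pr {ω | ¬ ∀ x, |μhat N (train N ω) x - μ x| ≤ c N} ≤ ENNReal.ofReal (d N)) ∨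
  Tendsto (fun N => ∫⁻ ω, ∫⁻ z, ENNReal.ofReal ((μhat N (train N ω) z.1 - μ z.1) ^ 2) ∂π ∂Pr)
    atTop (𝓝 0)

/-- `a n N → 0` as `n, N → ∞`, whatever the order of the limits: jointly, first in `n` and then in
`N`, and first in `N` and then in `n` (the inner limit need not exist, so it is an upper limit). -/
def VanishesInAnyOrder (a : ℕ → ℕ → ℝ≥0∞) : Prop :=
  Tendsto (fun p : ℕ × ℕ => a p.1 p.2) (atTop ×ˢ atTop) (𝓝 0) ∧
  Tendsto (fun N => limsup (fun n => a n N) atTop) atTop (𝓝 0) ∧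
  Tendsto (fun n => limsup (fun N => a n N) atTop) atTop (𝓝 0)

/-- Asymptotic efficiency of the split conformal prediction interval, where `train N` is the
training sample of size `N`, and `Z N i`, `i = 1, …, n`, is the calibration sample of size `n` and
`Z N (n+1)` the test point that go with it. In probability, as `n, N → ∞` in any order:
`|q̂_{α,n} - q_α| → 0`; `|μ̂_N(X_{n+1}) - μ(X_{n+1})| → 0`; and the Lebesgue measure of the
symmetric difference of the conformal interval `[μ̂_N(X_{n+1}) ± q̂_{α,n}]` and the oracle interval
`[μ(X_{n+1}) ± q_α]` tends to `0`. -/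
def AsymptoticallyEfficient {Ω X : Type*} [MeasurableSpace Ω] (Pr : Measure Ω)
    (train : (N : ℕ) → Ω → Fin N → X × ℝ) (Z : (N : ℕ) → ℕ → Ω → X × ℝ)
    (μhat : (N : ℕ) → (Fin N → X × ℝ) → X → ℝ) (μ : X → ℝ) (α q : ℝ) : Prop :=
  let m (N : ℕ) (ω : Ω) : X → ℝ := μhat N (train N ω)
  let qhat (n N : ℕ) (ω : Ω) : EReal := conformalQuantile α (m N ω) (past (Z N) n ω)
  let x (n N : ℕ) (ω : Ω) : X := (Z N (n + 1) ω).1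
  ∀ ε : ℝ, 0 < ε →
    VanishesInAnyOrder (fun n N => Pr {ω | ENNReal.ofReal ε < (qhat n N ω - (q : EReal)).abs}) ∧
    VanishesInAnyOrder (fun n N => Pr {ω | ε < |m N ω (x n N ω) - μ (x n N ω)|}) ∧
    VanishesInAnyOrder (fun n N => Pr {ω | ENNReal.ofReal ε <
      volume (symmDiff (interval (m N ω (x n N ω)) (qhat n N ω))
        (interval (μ (x n N ω)) (q : EReal)))})

end ConformalMarkov

end

/-!
The oracle quantile is stable: since the law of `|Y - μ(X)|` has a density bounded below near `q_α`,
its distribution function exceeds `1 - α` by a fixed amount at `q_α + ε` and falls short of it by a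
fixed amount at `q_α - ε` (`exists_cdf_gap`). So `q̂` can miss `q_α` by more than `ε` only if, at one
of these two points, the empirical distribution function of the scores is far from that of
`|Y - μ(X)|` (`deviation_of_lt_empQuantile_sub`). This has small probability for two reasons.

* Either kind of consistency makes `π{|μ̂_N - μ| > δ}` small in mean, hence small outside a set of
  training samples of small probability (`Consistent.tendsto_lintegral_measure`). For the other
  training samples the laws of `|Y - μ̂_N(X)|` and `|Y - μ(X)|` under `π` are close
  (`measureReal_abs_sub_le`).
* The empirical distribution function of the scores is close to that of `|Y - μ̂_N(X)|` under `π`.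
  If a fixed number `a` of calibration points is dropped, which does not matter as `n → ∞`, then
  the remaining ones may be taken to be independent of the training sample, at the cost of
  `β(a + 1)` (`Decouples.measure_le_lintegral`). For a fixed training sample, Chebyshev's
  inequality applies: covariances are bounded by `β` of the time lag and biases by the distance
  of `ν K^k` to `π`, so that the mean squared deviation of the frequency is at most
  a Cesàro mean of null sequences (`measureReal_frequency_deviation_le`). The bound is
  uniform in the training sample and in `N`.

Decoupling the test point from the training sample in the same way gives
`μ̂_N(X_{n+1}) - μ(X_{n+1}) → 0` in probability. Two intervals whose centres and radii are close have
a small symmetric difference (`volume_symmDiff_interval_le`). All bounds hold for `n` and `N` large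
independently of each other, so the joint limit gives the iterated ones.

The only properties of the two sampling schemes that enter are collected in `Decouples`, which holds
when calibration and test data continue the training chain (`IsMarkovChain.decouples`) and when they
come from an independent chain (`IsMarkovChain.decouples_of_indepFun`).
-/

namespace ConformalMarkov

/-! ### Total variation -/

section TotalVariation

variable {S : Type*} [MeasurableSpace S]

theorem tv_le_one (P Q : Measure S) [IsProbabilityMeasure P] [IsProbabilityMeasure Q] :
    tv P Q ≤ 1 := by
  refine iSup₂_le fun A _ => ?_
  rw [ENNReal.ofReal_le_one, abs_le]
  constructor <;>
    linarith [measureReal_nonneg (μ := P) (s := A), measureReal_nonneg (μ := Q) (s := A),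
      measureReal_le_one (μ := P) (s := A), measureReal_le_one (μ := Q) (s := A)]

theorem abs_measureReal_sub_le_of_tv_le {P Q : Measure S} {b : ℝ≥0∞} (hb : b ≠ ∞)
    (h : tv P Q ≤ b) {A : Set S} (hA : MeasurableSet A) : |P.real A - Q.real A| ≤ b.toReal := by
  rw [← ENNReal.ofReal_le_iff_le_toReal hb]
  exact (le_iSup₂ (f := fun (A : Set S) (_ : MeasurableSet A) =>
    ENNReal.ofReal |P.real A - Q.real A|) A hA).trans h

end TotalVariation

/-! ### A weak law of large numbers -/

section WeakLaw

variable {Ω S : Type*} [MeasurableSpace Ω] [MeasurableSpace S]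

theorem integral_centred_indicator_mul_le (Pr : Measure Ω) [IsProbabilityMeasure Pr]
    {E F : Set Ω} (hE : MeasurableSet E) (hF : MeasurableSet F) {p β : ℝ} (hp : 0 ≤ p)
    (hp' : p ≤ 1) (h : |Pr.real (E ∩ F) - Pr.real E * Pr.real F| ≤ β) :
    ∫ ω, (E.indicator 1 ω - p) * (F.indicator 1 ω - p) ∂Pr ≤ β + |Pr.real E - p| := by
  have hiE : Integrable (E.indicator (1 : Ω → ℝ)) Pr := (integrable_const (1 : ℝ)).indicator hE
  have hiF : Integrable (F.indicator (1 : Ω → ℝ)) Pr := (integrable_const (1 : ℝ)).indicator hF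
  have hiEF : Integrable ((E ∩ F).indicator (1 : Ω → ℝ)) Pr :=
    (integrable_const (1 : ℝ)).indicator (hE.inter hF)
  have hexp : ∀ ω, (E.indicator (1 : Ω → ℝ) ω - p) * (F.indicator 1 ω - p)
      = (E ∩ F).indicator 1 ω - p * E.indicator 1 ω - p * F.indicator 1 ω + p * p := by
    intro ω
    have : (E ∩ F).indicator (1 : Ω → ℝ) ω = E.indicator 1 ω * F.indicator 1 ω := by
      rw [Set.inter_indicator_one]; rfl
    rw [this]; ring
  simp_rw [hexp]
  rw [integral_add (by fun_prop) (by fun_prop), integral_sub (by fun_prop) (by fun_prop),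
    integral_sub (by fun_prop) (by fun_prop), integral_const_mul, integral_const_mul,
    integral_indicator_one hE, integral_indicator_one hF, integral_indicator_one (hE.inter hF)]
  simp only [integral_const, probReal_univ, smul_eq_mul, one_mul]
  have h1 := (abs_le.1 h).2
  have h2 : (Pr.real E - p) * (Pr.real F - p) ≤ |Pr.real E - p| := by
    refine (le_abs_self _).trans ?_
    rw [abs_mul]
    refine mul_le_of_le_one_right (abs_nonneg _) ?_
    rw [abs_le]
    constructor <;> linarith [measureReal_nonneg (μ := Pr) (s := F),
      measureReal_le_one (μ := Pr) (s := F)]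
  linarith

theorem sum_dist_le (B : ℕ → ℝ) (hB : ∀ k, 0 ≤ B k) {m k : ℕ} (hk : k < m) :
    ∑ l ∈ Finset.range m, B (Nat.dist k l) ≤ 2 * ∑ j ∈ Finset.range m, B j := by
  have key : ∀ s ⊆ Finset.range m, Set.InjOn (Nat.dist k) s →
      ∑ l ∈ s, B (Nat.dist k l) ≤ ∑ j ∈ Finset.range m, B j := by
    intro s hs hinj
    rw [← Finset.sum_image (g := Nat.dist k) (f := B) hinj]
    refine Finset.sum_le_sum_of_subset_of_nonneg ?_ fun _ _ _ => hB _
    intro j hj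
    obtain ⟨l, hl, rfl⟩ := Finset.mem_image.1 hj
    have := Finset.mem_range.1 (hs hl)
    simp only [Finset.mem_range, Nat.dist]
    omega
  rw [← Finset.sum_filter_add_sum_filter_not _ (fun l => l ≤ k), two_mul]
  refine add_le_add (key _ (Finset.filter_subset _ _) ?_) (key _ (Finset.filter_subset _ _) ?_)
  all_goals
    intro x hx y hy hxy
    simp only [Finset.coe_filter, Finset.mem_range, Set.mem_ofPred_eq] at hx hy
    simp only [Nat.dist] at hxy
    omega

/-- Chebyshev's inequality for the frequency of visits to `A`. Covariances that decay with the time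
lag and marginal probabilities that approach `p` leave a variance bound made of averages of the
two rates. -/
theorem measureReal_frequency_deviation_le (Pr : Measure Ω) [IsProbabilityMeasure Pr]
    {V : ℕ → Ω → S} (hV : ∀ k, Measurable (V k)) {A : Set S} (hA : MeasurableSet A)
    {p : ℝ} (hp : 0 ≤ p) (hp' : p ≤ 1) {B B' : ℕ → ℝ} (hB : ∀ k, 0 ≤ B k) (hB0 : 1 ≤ B 0)
    (hpair : ∀ k l, k < l → |Pr.real (V k ⁻¹' A ∩ V l ⁻¹' A)
      - Pr.real (V k ⁻¹' A) * Pr.real (V l ⁻¹' A)| ≤ B (l - k))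
    (hmarg : ∀ k, |Pr.real (V k ⁻¹' A) - p| ≤ B' k) {c : ℝ} (hc : 0 < c) {m : ℕ} (hm : 0 < m) :
    Pr.real {ω | c * m ≤ |∑ k ∈ Finset.range m, A.indicator 1 (V k ω) - m * p|}
      ≤ (c ^ 2)⁻¹ * (2 * ((m : ℝ)⁻¹ * ∑ k ∈ Finset.range m, B k)
        + (m : ℝ)⁻¹ * ∑ k ∈ Finset.range m, B' k) := by
  have hm' : (0 : ℝ) < m := by exact_mod_cast hm
  set x : ℕ → Ω → ℝ := fun k ω => (V k ⁻¹' A).indicator 1 ω - p with hx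
  have hxm : ∀ k, Measurable (x k) := fun k =>
    (measurable_one.indicator (hV k hA)).sub_const p
  have hx1 : ∀ k ω, |x k ω| ≤ 1 := by
    intro k ω
    have h0 : 0 ≤ (V k ⁻¹' A).indicator (1 : Ω → ℝ) ω := Set.indicator_nonneg (by simp) ω
    have h1 : (V k ⁻¹' A).indicator (1 : Ω → ℝ) ω ≤ 1 :=
      Set.indicator_le_self' (by simp) ω
    rw [abs_le]
    constructor <;> linarith
  have hxi : ∀ k l, Integrable (fun ω => x k ω * x l ω) Pr := by
    intro k l
    refine Integrable.of_bound ((hxm k).mul (hxm l)).aestronglyMeasurable 1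
      (ae_of_all _ fun ω => ?_)
    rw [Real.norm_eq_abs, abs_mul]
    exact mul_le_one₀ (hx1 k ω) (abs_nonneg _) (hx1 l ω)
  have hcov : ∀ k l, ∫ ω, x k ω * x l ω ∂Pr ≤ B (Nat.dist k l) + B' k := by
    intro k l
    rcases lt_trichotomy k l with h | rfl | h
    · rw [Nat.dist_eq_sub_of_le h.le]
      exact (integral_centred_indicator_mul_le Pr (hV k hA) (hV l hA) hp hp' (hpair k l h)).trans
        (by linarith [hmarg k])
    · have h1 : ∫ ω, x k ω * x k ω ∂Pr ≤ ∫ _, (1 : ℝ) ∂Pr := by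
        refine integral_mono (hxi k k) (integrable_const _) fun ω => ?_
        have := hx1 k ω
        rw [← abs_mul_abs_self]
        exact mul_le_one₀ this (abs_nonneg _) this
      simp only [integral_const, probReal_univ, smul_eq_mul, one_mul] at h1
      rw [Nat.dist_self]
      linarith [(abs_nonneg _).trans (hmarg k)]
    · rw [Nat.dist_eq_sub_of_le_right h.le]
      refine (integral_centred_indicator_mul_le Pr (hV k hA) (hV l hA) hp hp' (β := B (k - l))
        ?_).trans (by linarith [hmarg k])
      rw [Set.inter_comm, mul_comm]
      exact hpair l k h
  have hsum : ∀ ω, ∑ k ∈ Finset.range m, A.indicator 1 (V k ω) - m * p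
      = ∑ k ∈ Finset.range m, x k ω := by
    intro ω
    simp only [hx, Finset.sum_sub_distrib, Finset.sum_const, Finset.card_range, nsmul_eq_mul]
    rfl
  have hsq : ∀ ω, (∑ k ∈ Finset.range m, x k ω) ^ 2
      = ∑ k ∈ Finset.range m, ∑ l ∈ Finset.range m, x k ω * x l ω := by
    intro ω; rw [sq, Finset.sum_mul_sum]
  have hint : Integrable (fun ω => (∑ k ∈ Finset.range m, x k ω) ^ 2) Pr := by
    simp_rw [hsq]
    exact integrable_finsetSum _ fun k _ => integrable_finsetSum _ fun l _ => hxi k l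
  have hvar : ∫ ω, (∑ k ∈ Finset.range m, x k ω) ^ 2 ∂Pr
      ≤ m * (2 * ∑ k ∈ Finset.range m, B k) + m * ∑ k ∈ Finset.range m, B' k := by
    simp_rw [hsq]
    rw [integral_finsetSum _ fun k _ => integrable_finsetSum _ fun l _ => hxi k l]
    have : ∀ k ∈ Finset.range m, ∫ ω, ∑ l ∈ Finset.range m, x k ω * x l ω ∂Pr
        ≤ 2 * ∑ j ∈ Finset.range m, B j + m * B' k := by
      intro k hk
      rw [integral_finsetSum _ fun l _ => hxi k l]
      refine (Finset.sum_le_sum fun l _ => hcov k l).trans ?_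
      rw [Finset.sum_add_distrib]
      simp only [Finset.sum_const, Finset.card_range, nsmul_eq_mul]
      linarith [sum_dist_le B hB (Finset.mem_range.1 hk)]
    refine (Finset.sum_le_sum this).trans (le_of_eq ?_)
    rw [Finset.sum_add_distrib, Finset.mul_sum (f := B')]
    simp
  have hmarkov := mul_meas_ge_le_integral_of_nonneg (μ := Pr)
    (f := fun ω => (∑ k ∈ Finset.range m, x k ω) ^ 2) (ae_of_all _ fun ω => sq_nonneg _) hint
    ((c * m) ^ 2)
  have hset : {ω | c * m ≤ |∑ k ∈ Finset.range m, A.indicator 1 (V k ω) - m * p|}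
      = {ω | (c * m) ^ 2 ≤ (∑ k ∈ Finset.range m, x k ω) ^ 2} := by
    ext ω
    simp only [Set.mem_ofPred_eq]
    rw [hsum, sq_le_sq, abs_of_pos (mul_pos hc hm')]
  rw [hset]
  have h3 := hmarkov.trans hvar
  rw [← le_div_iff₀' (by positivity)] at h3
  refine h3.trans (le_of_eq ?_)
  field_simp

end WeakLaw

/-! ### Quantiles -/

section Quantile

variable {X : Type*} [MeasurableSpace X]

theorem cdf_residualLaw (π : Measure (X × ℝ)) [IsProbabilityMeasure π] {μ : X → ℝ}
    (hμ : Measurable μ) (t : ℝ) :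
    cdf (residualLaw π μ) t = π.real {z | |z.2 - μ z.1| ≤ t} := by
  have hr : Measurable fun z : X × ℝ => |z.2 - μ z.1| := by fun_prop
  have : IsProbabilityMeasure (residualLaw π μ) := Measure.isProbabilityMeasure_map hr.aemeasurable
  rw [cdf_eq_real, residualLaw, map_measureReal_apply hr measurableSet_Iic]
  rfl

theorem cdf_lt_of_lt_quantile {m : Measure ℝ} {p t : ℝ} (hp : 0 < p) (ht : t < quantile m p) :
    cdf m t < p := by
  have hbdd : BddBelow {q : ℝ | p ≤ cdf m q} := by
    obtain ⟨t₀, ht₀⟩ := ((tendsto_cdf_atBot m).eventually_lt_const hp).exists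
    refine ⟨t₀, fun q hq => ?_⟩
    by_contra! hlt
    exact (hq.trans (monotone_cdf m hlt.le)).not_gt ht₀
  exact not_le.1 fun h => ht.not_ge (csInf_le hbdd h)

theorem le_cdf_of_quantile_lt {m : Measure ℝ} {p t : ℝ} (hp : p < 1) (ht : quantile m p < t) :
    p ≤ cdf m t := by
  have hne : {q : ℝ | p ≤ cdf m q}.Nonempty :=
    ((tendsto_cdf_atTop m).eventually_const_le hp).exists
  obtain ⟨q, hq, hqt⟩ := exists_lt_of_csInf_lt hne ht
  exact le_trans hq (monotone_cdf m hqt.le)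

/-- Near its quantile, a law whose density is bounded below has a distribution function that grows
at least linearly; so the quantile is well separated. -/
theorem exists_cdf_gap {m : Measure ℝ} [IsProbabilityMeasure m] {p : ℝ} (hp : 0 < p) (hp' : p < 1)
    (h : HasDensityBoundedBelowNear m (quantile m p)) {ε : ℝ} (hε : 0 < ε) :
    ∃ c > 0, p + c ≤ cdf m (quantile m p + ε) ∧ cdf m (quantile m p - ε) ≤ p - c := by
  obtain ⟨f, hf, hm, κ, hκ, η, hη, hfκ⟩ := h
  set q := quantile m p
  obtain ⟨δ, hδ, hδε, hδη⟩ : ∃ δ > 0, δ ≤ ε ∧ δ < η :=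
    ⟨min ε (η / 2), lt_min hε (half_pos hη), min_le_left _ _, (min_le_right _ _).trans_lt
      (half_lt_self hη)⟩
  have hIoc : ∀ a b, a ≤ b → q - δ ≤ a → b ≤ q + δ → cdf m a + κ * (b - a) ≤ cdf m b := by
    intro a b hab ha hb
    have h1 : ENNReal.ofReal (κ * (b - a)) ≤ m (Set.Ioc a b) := by
      rw [hm, withDensity_apply _ measurableSet_Ioc, ENNReal.ofReal_mul hκ.le]
      calc ENNReal.ofReal κ * ENNReal.ofReal (b - a)
          = ∫⁻ _ in Set.Ioc a b, ENNReal.ofReal κ := by simp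
        _ ≤ ∫⁻ t in Set.Ioc a b, f t := by
          refine setLIntegral_mono hf fun t ht => hfκ t ?_
          rw [abs_lt]
          constructor <;> linarith [ht.1, ht.2]
    rw [← measure_cdf m, StieltjesFunction.measure_Ioc,
      ENNReal.ofReal_le_ofReal_iff (sub_nonneg.2 (monotone_cdf m hab))] at h1
    linarith
  refine ⟨κ * (δ / 2), by positivity, ?_, ?_⟩
  · have h1 := hIoc (q + δ / 2) (q + δ) (by linarith) (by linarith) le_rfl
    have h2 : p ≤ cdf m (q + δ / 2) := le_cdf_of_quantile_lt hp' (by simpa [q] using hδ)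
    have h3 := monotone_cdf m (show q + δ ≤ q + ε by linarith)
    have : κ * (q + δ - (q + δ / 2)) = κ * (δ / 2) := by ring
    linarith
  · have h1 := hIoc (q - δ) (q - δ / 2) (by linarith) le_rfl (by linarith)
    have h2 : cdf m (q - δ / 2) < p := cdf_lt_of_lt_quantile hp (by simpa [q] using hδ)
    have h3 := monotone_cdf m (show q - ε ≤ q - δ by linarith)
    have : κ * (q - δ / 2 - (q - δ)) = κ * (δ / 2) := by ring
    linarith

theorem card_lt_of_lt_empQuantile {α : ℝ} {n : ℕ} {s : Fin n → ℝ} {t : ℝ}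
    (h : (t : EReal) < empQuantile α s) :
    Nat.card {i : Fin n // s i ≤ t} < ⌈((n : ℝ) + 1) * (1 - α)⌉₊ := by
  have := notMem_of_lt_csInf h (OrderBot.bddBelow _)
  simpa only [Set.mem_ofPred_eq, not_le, EReal.coe_le_coe_iff] using this

theorem le_card_of_empQuantile_lt {α : ℝ} {n : ℕ} {s : Fin n → ℝ} {t : ℝ}
    (h : empQuantile α s < (t : EReal)) :
    ⌈((n : ℝ) + 1) * (1 - α)⌉₊ ≤ Nat.card {i : Fin n // s i ≤ t} := by
  obtain ⟨q, hq, hqt⟩ := sInf_lt_iff.1 h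
  refine le_trans hq (Nat.card_le_card_of_injective
    (fun i => ⟨i.1, EReal.coe_le_coe_iff.1 (i.2.trans hqt.le)⟩) fun i j hij => ?_)
  exact Subtype.ext (by simpa using hij)

theorem card_fin_eq_sum_indicator {S : Type*} (A : Set S) (w : ℕ → S) (n : ℕ) :
    (Nat.card {i : Fin n // w i ∈ A} : ℝ) = ∑ i ∈ Finset.range n, A.indicator 1 (w i) := by
  classical
  rw [Nat.card_eq_fintype_card, Fintype.card_subtype, ← Fin.sum_univ_eq_sum_range
    (fun i => A.indicator (1 : S → ℝ) (w i))]
  simp [Set.indicator_apply]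

theorem coe_lt_or_lt_coe_of_lt_abs {r : EReal} {q ε : ℝ}
    (h : ENNReal.ofReal ε < (r - (q : EReal)).abs) :
    ((q + ε : ℝ) : EReal) < r ∨ r < ((q - ε : ℝ) : EReal) := by
  by_contra! hr
  induction r with
  | bot => exact hr.2.not_gt (EReal.bot_lt_coe _)
  | top => exact hr.1.not_gt (EReal.coe_lt_top _)
  | coe r =>
    rw [EReal.coe_le_coe_iff, EReal.coe_le_coe_iff] at hr
    rw [← EReal.coe_sub, EReal.abs_def] at h
    refine h.not_ge (ENNReal.ofReal_le_ofReal ?_)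
    rw [abs_le]
    constructor <;> linarith [hr.1, hr.2]

end Quantile

/-! ### Symmetric differences of intervals -/

theorem volume_symmDiff_interval_le {a b s δ : ℝ} {r : EReal} (hab : |a - b| ≤ δ)
    (hr : (r - (s : EReal)).abs ≤ ENNReal.ofReal δ) :
    volume (symmDiff (interval a r) (interval b (s : EReal))) ≤ ENNReal.ofReal (8 * δ) := by
  have hδ : 0 ≤ δ := (abs_nonneg _).trans hab
  induction r with
  | bot => simp at hr
  | top => simp at hr
  | coe r =>
    rw [← EReal.coe_sub, EReal.abs_def, ENNReal.ofReal_le_ofReal_iff hδ] at hr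
    have hsub : symmDiff (interval a (r : EReal)) (interval b (s : EReal)) ⊆
        Set.Icc (b + s - 2 * δ) (b + s + 2 * δ) ∪ Set.Icc (b - s - 2 * δ) (b - s + 2 * δ) := by
      intro y hy
      simp only [Set.mem_symmDiff, interval, Set.mem_ofPred_eq, EReal.coe_le_coe_iff, not_le] at hy
      have h1 : |y - a| ≤ |y - b| + |a - b| := by
        rw [abs_sub_comm a b]; exact abs_sub_le y b a
      have h2 : |y - b| ≤ |y - a| + |a - b| := abs_sub_le y a b
      obtain ⟨h3, h4⟩ := abs_le.1 hr
      have h5 : s - 2 * δ ≤ |y - b| ∧ |y - b| ≤ s + 2 * δ := by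
        rcases hy with hy | hy <;> constructor <;> linarith [hy.1, hy.2]
      rcases abs_cases (y - b) with h | h
      · left; constructor <;> linarith [h5.1, h5.2]
      · right; constructor <;> linarith [h5.1, h5.2]
    refine (measure_mono hsub).trans ((measure_union_le _ _).trans (le_of_eq ?_))
    rw [Real.volume_Icc, Real.volume_Icc, ← ENNReal.ofReal_add (by linarith) (by linarith)]
    congr 1; ring

theorem vanishesInAnyOrder_of_tendsto {a : ℕ → ℕ → ℝ≥0∞}
    (h : Tendsto (fun p : ℕ × ℕ => a p.1 p.2) (atTop ×ˢ atTop) (𝓝 0)) :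
    VanishesInAnyOrder a := by
  refine ⟨h, ?_, ?_⟩ <;> rw [ENNReal.tendsto_nhds_zero] at h ⊢ <;> intro ε hε
  · have h' := tendsto_prod_swap.eventually (h ε hε)
    filter_upwards [h'.curry] with N hN using limsup_le_of_le (h := hN)
  · filter_upwards [(h ε hε).curry] with n hn using limsup_le_of_le (h := hn)

/-! ### Consistent estimators -/

section Consistency

variable {Ω X : Type*} [MeasurableSpace Ω] [MeasurableSpace X]

/-- Both notions of consistency imply that `μ̂_N → μ` in probability, for the product of the law of
the training sample and `π`. -/
theorem Consistent.tendsto_lintegral_measure {Pr : Measure Ω} {π : Measure (X × ℝ)}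
    [IsProbabilityMeasure π]
    {D : (N : ℕ) → Ω → Fin N → X × ℝ} {μhat : (N : ℕ) → (Fin N → X × ℝ) → X → ℝ} {μ : X → ℝ}
    (h : Consistent Pr π D μhat μ) (hD : ∀ N, Measurable (D N)) (hμ : Measurable μ)
    (hμhat : ∀ N, Measurable fun p : (Fin N → X × ℝ) × X => μhat N p.1 p.2)
    {δ : ℝ} (hδ : 0 < δ) :
    Tendsto (fun N => ∫⁻ ω, π {z | δ < |μhat N (D N ω) z.1 - μ z.1|} ∂Pr) atTop (𝓝 0) := by
  have hdiff : ∀ N, Measurable fun p : Ω × (X × ℝ) => μhat N (D N p.1) p.2.1 - μ p.2.1 := fun N =>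
    ((hμhat N).comp (((hD N).comp measurable_fst).prodMk measurable_snd.fst)).sub
      (hμ.comp measurable_snd.fst)
  rcases h with ⟨c, d, hc, hd, hcd⟩ | h
  · have hd' : Tendsto (fun N => ENNReal.ofReal (d N)) atTop (𝓝 0) := by
      simpa using ENNReal.tendsto_ofReal hd
    refine tendsto_of_tendsto_of_tendsto_of_le_of_le' tendsto_const_nhds hd'
      (Eventually.of_forall fun _ => zero_le) ?_
    filter_upwards [hc.eventually_lt_const hδ] with N hN
    have hmeas : Measurable fun ω => π {z | δ < |μhat N (D N ω) z.1 - μ z.1|} :=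
      measurable_measure_prodMk_left (ν := π) (measurableSet_lt measurable_const (hdiff N).abs)
    set T : Set Ω := {ω | π {z | δ < |μhat N (D N ω) z.1 - μ z.1|} ≠ 0}
    have hT : MeasurableSet T := (hmeas (measurableSet_singleton 0)).compl
    calc ∫⁻ ω, π {z | δ < |μhat N (D N ω) z.1 - μ z.1|} ∂Pr
        ≤ ∫⁻ ω, T.indicator 1 ω ∂Pr := by
          refine lintegral_mono fun ω => ?_
          by_cases hω : ω ∈ T
          · rw [Set.indicator_of_mem hω]; exact prob_le_one
          · rw [Set.indicator_of_notMem hω]; exact (not_not.1 hω).le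
      _ = Pr T := lintegral_indicator_one hT
      _ ≤ Pr {ω | ¬ ∀ x, |μhat N (D N ω) x - μ x| ≤ c N} := by
          refine measure_mono fun ω hω hall => hω ?_
          have : {z : X × ℝ | δ < |μhat N (D N ω) z.1 - μ z.1|} = ∅ :=
            Set.eq_empty_of_forall_notMem fun z hz => ((hall z.1).trans hN.le).not_gt hz
          rw [this, measure_empty]
      _ ≤ ENNReal.ofReal (d N) := hcd N
  · have hδ2 : ENNReal.ofReal (δ ^ 2) ≠ 0 := by simpa using hδ.ne'
    have hlim := ENNReal.Tendsto.mul_const (b := (ENNReal.ofReal (δ ^ 2))⁻¹) h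
      (Or.inr (ENNReal.inv_ne_top.2 hδ2))
    rw [zero_mul] at hlim
    refine tendsto_of_tendsto_of_tendsto_of_le_of_le tendsto_const_nhds hlim
      (fun _ => zero_le) fun N => ?_
    dsimp only
    rw [← lintegral_mul_const' _ _ (ENNReal.inv_ne_top.2 hδ2)]
    refine lintegral_mono fun ω => ?_
    have hm : Measurable fun z : X × ℝ =>
        ENNReal.ofReal ((μhat N (D N ω) z.1 - μ z.1) ^ 2) :=
      (((hdiff N).comp (measurable_prodMk_left (x := ω))).pow_const 2).ennreal_ofReal
    refine (measure_mono fun z hz => ?_).trans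
      (meas_ge_le_lintegral_div hm.aemeasurable hδ2 ENNReal.ofReal_ne_top)
    refine ENNReal.ofReal_le_ofReal (sq_le_sq' ?_ ?_ |>.trans_eq (sq_abs _))
    · have : δ < |μhat N (D N ω) z.1 - μ z.1| := hz
      linarith
    · exact le_of_lt hz

end Consistency

/-! ### Decoupling of the training sample from later observations -/

/-- The training samples `D N` and the observations `Z N 1, Z N 2, …` that follow them are
asymptotically independent, and the latter are asymptotically independent among themselves and
asymptotically distributed according to `π`, everything at the rate `b`, uniformly in the size `N`
of the training sample. The normalisation `1 ≤ b 0` lets `b 0` bound the summands without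
time lag in a second moment. The empty training sample is exempt, since `β`-mixing coefficients say
nothing about it. -/
structure Decouples {Ω S : Type*} [MeasurableSpace Ω] [MeasurableSpace S] (Pr : Measure Ω)
    (D : (N : ℕ) → Ω → Fin N → S) (Z : ℕ → ℕ → Ω → S) (π : Measure S) (b : ℕ → ℝ) : Prop where
  measurable_train : ∀ N, Measurable (D N)
  measurable : ∀ N i, Measurable (Z N i)
  nonneg : ∀ k, 0 ≤ b k
  one_le : 1 ≤ b 0
  tendsto : Tendsto b atTop (𝓝 0)
  joint : ∀ N a, 1 ≤ N → 1 ≤ a → ∀ E : Set ((Fin N → S) × (ℕ → S)), MeasurableSet E →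
    |(Pr.map fun ω => (D N ω, future (Z N) a ω)).real E
      - ((Pr.map (D N)).prod (Pr.map (future (Z N) a))).real E| ≤ b a
  pair : ∀ N i j, 1 ≤ i → i < j → ∀ A : Set S, MeasurableSet A →
    |Pr.real (Z N i ⁻¹' A ∩ Z N j ⁻¹' A) - Pr.real (Z N i ⁻¹' A) * Pr.real (Z N j ⁻¹' A)|
      ≤ b (j - i)
  marginal : ∀ N i (A : Set S), MeasurableSet A → |Pr.real (Z N i ⁻¹' A) - π.real A| ≤ b i

theorem measurable_future {Ω S : Type*} [MeasurableSpace Ω] [MeasurableSpace S] {W : ℕ → Ω → S}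
    (hW : ∀ k, Measurable (W k)) (s : ℕ) : Measurable (future W s) :=
  measurable_pi_lambda _ fun _ => hW _

theorem measurable_past {Ω S : Type*} [MeasurableSpace Ω] [MeasurableSpace S] {W : ℕ → Ω → S}
    (hW : ∀ k, Measurable (W k)) (t : ℕ) : Measurable (past W t) :=
  measurable_pi_lambda _ fun _ => hW _

/-- The bound that Chebyshev's inequality gives for the probability that, among `m` observations
from time `a` on, a frequency deviates from its limit by `c` or more. -/
noncomputable def deviationBound (b : ℕ → ℝ) (a : ℕ) (c : ℝ) (m : ℕ) : ℝ :=
  (c ^ 2)⁻¹ * (2 * ((m : ℝ)⁻¹ * ∑ k ∈ Finset.range m, b k)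
    + (m : ℝ)⁻¹ * ∑ k ∈ Finset.range m, b (a + k))

theorem tendsto_deviationBound {b : ℕ → ℝ} (hb : Tendsto b atTop (𝓝 0)) (a : ℕ) (c : ℝ) :
    Tendsto (deviationBound b a c) atTop (𝓝 0) := by
  have h1 := hb.cesaro
  have h2 := (hb.comp (tendsto_add_atTop_nat a)).cesaro
  have := ((h1.const_mul 2).add h2).const_mul (c ^ 2)⁻¹
  simp only [mul_zero, add_zero] at this
  refine this.congr fun m => ?_
  simp [deviationBound, add_comm a]

namespace Decouples

variable {Ω S : Type*} [MeasurableSpace Ω] [MeasurableSpace S] {Pr : Measure Ω}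
  [IsProbabilityMeasure Pr] {D : (N : ℕ) → Ω → Fin N → S} {Z : ℕ → ℕ → Ω → S} {π : Measure S}
  {b : ℕ → ℝ}

/-- Up to an error `b a`, the observations from time `a` on may be replaced by an independent copy,
in any event that involves them and the training sample. -/
theorem measure_le_lintegral (h : Decouples Pr D Z π b) {N a : ℕ} (hN : 1 ≤ N) (ha : 1 ≤ a)
    {E : Set ((Fin N → S) × (ℕ → S))} (hE : MeasurableSet E) :
    Pr {ω | (D N ω, future (Z N) a ω) ∈ E}
      ≤ ENNReal.ofReal (b a) + ∫⁻ ω, Pr {ω' | (D N ω, future (Z N) a ω') ∈ E} ∂Pr := by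
  have hD := h.measurable_train N
  have hF := measurable_future (h.measurable N) a
  have := Measure.isProbabilityMeasure_map (μ := Pr) hD.aemeasurable
  have := Measure.isProbabilityMeasure_map (μ := Pr) hF.aemeasurable
  have h1 := (abs_le.1 (h.joint N a hN ha E hE)).2
  rw [map_measureReal_apply (hD.prodMk hF) hE] at h1
  have h2 : Pr.real {ω | (D N ω, future (Z N) a ω) ∈ E}
      ≤ b a + ((Pr.map (D N)).prod (Pr.map (future (Z N) a))).real E := by
    have : Pr.real {ω | (D N ω, future (Z N) a ω) ∈ E}
      = Pr.real ((fun ω => (D N ω, future (Z N) a ω)) ⁻¹' E) := rfl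
    linarith
  have h3 := ENNReal.ofReal_le_ofReal h2
  rw [ofReal_measureReal, ENNReal.ofReal_add (h.nonneg a) measureReal_nonneg,
    ofReal_measureReal, Measure.prod_apply hE,
    lintegral_map (measurable_measure_prodMk_left hE) hD] at h3
  refine h3.trans (le_of_eq ?_)
  congr 1
  refine lintegral_congr fun ω => ?_
  rw [Measure.map_apply hF (measurable_prodMk_left hE)]
  rfl

theorem measure_test_le (h : Decouples Pr D Z π b) [IsProbabilityMeasure π] {N i : ℕ}
    (hN : 1 ≤ N) (hi : 1 ≤ i) {R : Set ((Fin N → S) × S)} (hR : MeasurableSet R) :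
    Pr {ω | (D N ω, Z N i ω) ∈ R}
      ≤ 2 * ENNReal.ofReal (b i) + ∫⁻ ω, π {z | (D N ω, z) ∈ R} ∂Pr := by
  have hE : MeasurableSet {p : (Fin N → S) × (ℕ → S) | (p.1, p.2 0) ∈ R} :=
    (measurable_fst.prodMk ((measurable_pi_apply 0).comp measurable_snd)) hR
  refine (h.measure_le_lintegral hN hi hE).trans ?_
  rw [two_mul, add_assoc]
  refine add_le_add le_rfl ?_
  calc ∫⁻ ω, Pr {ω' | (D N ω, Z N i ω') ∈ R} ∂Pr
      ≤ ∫⁻ ω, (ENNReal.ofReal (b i) + π {z | (D N ω, z) ∈ R}) ∂Pr := by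
        refine lintegral_mono fun ω => ?_
        have h1 := (abs_le.1 (h.marginal N i _ (measurable_prodMk_left (x := D N ω) hR))).2
        have h2 := ENNReal.ofReal_le_ofReal (sub_le_iff_le_add.1 h1)
        rwa [ENNReal.ofReal_add (h.nonneg i) measureReal_nonneg, ofReal_measureReal,
          ofReal_measureReal] at h2
    _ = ENNReal.ofReal (b i) + ∫⁻ ω, π {z | (D N ω, z) ∈ R} ∂Pr := by
        rw [lintegral_add_left measurable_const]; simp

/-- A law of large numbers for sets that depend on the training sample. -/
theorem measure_frequency_deviation_le (h : Decouples Pr D Z π b) [IsProbabilityMeasure π]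
    {N a : ℕ} (hN : 1 ≤ N) (ha : 1 ≤ a) {R : Set ((Fin N → S) × S)} (hR : MeasurableSet R)
    {c : ℝ} (hc : 0 < c) {m : ℕ} (hm : 0 < m) :
    Pr {ω | c * m ≤ |∑ k ∈ Finset.range m, {z | (D N ω, z) ∈ R}.indicator 1 (Z N (a + k) ω)
        - m * π.real {z | (D N ω, z) ∈ R}|}
      ≤ ENNReal.ofReal (b a) + ENNReal.ofReal (deviationBound b a c m) := by
  set E : Set ((Fin N → S) × (ℕ → S)) :=
    {p | c * m ≤ |∑ k ∈ Finset.range m, R.indicator (1 : (Fin N → S) × S → ℝ) (p.1, p.2 k)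
      - m * π.real {z | (p.1, z) ∈ R}|}
  have hE : MeasurableSet E := by
    refine measurableSet_le measurable_const (Measurable.abs (Measurable.sub ?_ ?_))
    · exact Finset.measurable_fun_sum _ fun k _ => (measurable_one.indicator hR).comp
        (measurable_fst.prodMk ((measurable_pi_apply k).comp measurable_snd))
    · exact (((measurable_measure_prodMk_left (ν := π) hR).ennreal_toReal).comp
        measurable_fst).const_mul _
  refine (h.measure_le_lintegral hN ha hE).trans (add_le_add le_rfl ?_)
  calc ∫⁻ ω, Pr {ω' | (D N ω, future (Z N) a ω') ∈ E} ∂Pr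
      ≤ ∫⁻ _, ENNReal.ofReal (deviationBound b a c m) ∂Pr := by
        refine lintegral_mono fun ω => ?_
        rw [← ofReal_measureReal (μ := Pr)]
        refine ENNReal.ofReal_le_ofReal ?_
        have hA : MeasurableSet {z | (D N ω, z) ∈ R} := measurable_prodMk_left hR
        refine measureReal_frequency_deviation_le Pr (V := fun k => Z N (a + k))
          (fun k => h.measurable N _) hA measureReal_nonneg measureReal_le_one h.nonneg h.one_le
          (fun k l hkl => ?_) (fun k => h.marginal N _ _ hA) hc hm
        have := h.pair N (a + k) (a + l) (by omega) (by omega) _ hA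
        rwa [Nat.add_sub_add_left] at this
    _ = ENNReal.ofReal (deviationBound b a c m) := by simp

end Decouples

/-! ### Efficiency of the conformal interval -/

section Efficiency

variable {X : Type*} [MeasurableSpace X]

/-- The distribution functions of `|Y - f(X)|` and `|Y - g(X)|` are close, up to a shift of the
argument, if `f` and `g` are close in probability. The bound is used in both directions, with the
regression function and its estimate as `f` and `g`. -/
theorem measureReal_abs_sub_le (π : Measure (X × ℝ)) [IsProbabilityMeasure π] (f g : X → ℝ)
    (t δ : ℝ) :
    π.real {z | |z.2 - f z.1| ≤ t}
      ≤ π.real {z | |z.2 - g z.1| ≤ t + δ} + π.real {z | δ < |f z.1 - g z.1|} := by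
  refine (measureReal_mono fun z hz => ?_).trans (measureReal_union_le _ _)
  by_cases h : δ < |f z.1 - g z.1|
  · exact Or.inr h
  · left
    have h1 : |z.2 - f z.1| ≤ t := hz
    have h2 := abs_sub_le z.2 (f z.1) (g z.1)
    simp only [Set.mem_ofPred_eq]
    linarith

/-- If `q̂` misses `q` by more than `ε`, then at `t = q + ε` or `t = q - ε` the fraction of scores
that are at most `t`, among those left when the first `a` are dropped, is far from its limit
`P t`. -/
theorem deviation_of_lt_empQuantile_sub {α c q ε : ℝ} (hα₀ : 0 < α) (hα₁ : α < 1) {a m : ℕ}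
    (hm : (a : ℝ) + 1 ≤ c * m)
    {s : ℕ → ℝ} {P : ℝ → ℝ} (hup : 1 - α + 2 * c ≤ P (q + ε)) (hlo : P (q - ε) ≤ 1 - α - 2 * c)
    (h : ENNReal.ofReal ε <
      (empQuantile α (fun i : Fin (a + m) => s i) - (q : EReal)).abs) :
    ∃ t, (t = q + ε ∨ t = q - ε) ∧
      c * m ≤ |∑ k ∈ Finset.range m, (Set.Iic t).indicator 1 (s (a + k)) - m * P t| := by
  have hcard : ∀ t, (Nat.card {i : Fin (a + m) // s i ≤ t} : ℝ)
      = ∑ k ∈ Finset.range a, (Set.Iic t).indicator (1 : ℝ → ℝ) (s k)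
        + ∑ k ∈ Finset.range m, (Set.Iic t).indicator 1 (s (a + k)) := by
    intro t
    rw [← Finset.sum_range_add, ← card_fin_eq_sum_indicator]
    rfl
  have h0 : ∀ t, 0 ≤ ∑ k ∈ Finset.range a, (Set.Iic t).indicator (1 : ℝ → ℝ) (s k) := fun t =>
    Finset.sum_nonneg fun k _ => Set.indicator_nonneg (by simp) _
  have h1 : ∀ t, ∑ k ∈ Finset.range a, (Set.Iic t).indicator (1 : ℝ → ℝ) (s k) ≤ a := fun t => by
    refine (Finset.sum_le_card_nsmul _ _ 1 fun k _ => ?_).trans (by simp)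
    exact Set.indicator_le_self' (by simp) _
  have hm0 : (0 : ℝ) ≤ m := m.cast_nonneg
  have ha0 : (0 : ℝ) ≤ a := a.cast_nonneg
  rcases coe_lt_or_lt_coe_of_lt_abs h with h | h
  · refine ⟨q + ε, Or.inl rfl, ?_⟩
    have h2 := Nat.lt_ceil.1 (card_lt_of_lt_empQuantile h)
    rw [hcard] at h2
    push_cast at h2
    rw [abs_sub_comm]
    refine le_trans ?_ (le_abs_self _)
    have h3 := mul_le_mul_of_nonneg_left hup hm0
    nlinarith [h0 (q + ε)]
  · refine ⟨q - ε, Or.inr rfl, ?_⟩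
    have h2 := Nat.ceil_le.1 (le_card_of_empQuantile_lt h)
    rw [hcard] at h2
    push_cast at h2
    refine le_trans ?_ (le_abs_self _)
    have h3 := mul_le_mul_of_nonneg_left hlo hm0
    nlinarith [h1 (q - ε)]

variable {Ω : Type*} [MeasurableSpace Ω] {Pr : Measure Ω} [IsProbabilityMeasure Pr]
  {D : (N : ℕ) → Ω → Fin N → X × ℝ} {Z : ℕ → ℕ → Ω → X × ℝ} {π : Measure (X × ℝ)}
  [IsProbabilityMeasure π] {b : ℕ → ℝ} {μ : X → ℝ} {μhat : (N : ℕ) → (Fin N → X × ℝ) → X → ℝ}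

theorem tendsto_measure_regression_error (h : Decouples Pr D Z π b) (hμ : Measurable μ)
    (hμhat : ∀ N, Measurable fun p : (Fin N → X × ℝ) × X => μhat N p.1 p.2)
    (hcons : Consistent Pr π D μhat μ) {ε : ℝ} (hε : 0 < ε) :
    Tendsto (fun p : ℕ × ℕ => Pr {ω | ε < |μhat p.2 (D p.2 ω) (Z p.2 (p.1 + 1) ω).1
      - μ (Z p.2 (p.1 + 1) ω).1|}) (atTop ×ˢ atTop) (𝓝 0) := by
  have h1 := hcons.tendsto_lintegral_measure h.measurable_train hμ hμhat hε
  have h2 : Tendsto (fun n => 2 * ENNReal.ofReal (b (n + 1))) atTop (𝓝 0) := by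
    have := ENNReal.Tendsto.const_mul (a := 2)
      (ENNReal.tendsto_ofReal (h.tendsto.comp (tendsto_add_atTop_nat 1))) (Or.inr (by simp))
    simpa using this
  have h3 := (h2.comp tendsto_fst).add (h1.comp tendsto_snd)
  rw [add_zero] at h3
  refine tendsto_of_tendsto_of_tendsto_of_le_of_le' tendsto_const_nhds h3
    (Eventually.of_forall fun _ => zero_le) ?_
  filter_upwards [tendsto_snd.eventually (eventually_ge_atTop 1)] with p hp
  refine h.measure_test_le hp (Nat.le_add_left 1 _)
    (R := {r | ε < |μhat p.2 r.1 r.2.1 - μ r.2.1|}) ?_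
  exact measurableSet_lt measurable_const (((hμhat p.2).comp
    (measurable_fst.prodMk measurable_snd.fst)).sub (hμ.comp measurable_snd.fst)).abs

theorem tendsto_measure_quantile_error (h : Decouples Pr D Z π b) (hμ : Measurable μ)
    (hμhat : ∀ N, Measurable fun p : (Fin N → X × ℝ) × X => μhat N p.1 p.2)
    (hcons : Consistent Pr π D μhat μ) {α : ℝ} (hα₀ : 0 < α) (hα₁ : α < 1)
    (hdens : HasDensityBoundedBelowNear (residualLaw π μ) (quantile (residualLaw π μ) (1 - α)))
    {ε : ℝ} (hε : 0 < ε) :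
    Tendsto (fun p : ℕ × ℕ => Pr {ω | ENNReal.ofReal ε <
      (conformalQuantile α (μhat p.2 (D p.2 ω)) (past (Z p.2) p.1 ω)
        - (quantile (residualLaw π μ) (1 - α) : EReal)).abs}) (atTop ×ˢ atTop) (𝓝 0) := by
  have : IsProbabilityMeasure (residualLaw π μ) :=
    Measure.isProbabilityMeasure_map (Measurable.aemeasurable (by fun_prop))
  obtain ⟨c, hc, hup, hlo⟩ := exists_cdf_gap (sub_pos.2 hα₁) (by linarith) hdens (half_pos hε)
  set q := quantile (residualLaw π μ) (1 - α)
  rw [cdf_residualLaw π hμ] at hup hlo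
  set G : ℕ → Ω → ℝ≥0∞ := fun N ω => π {z | ε / 2 < |μhat N (D N ω) z.1 - μ z.1|}
  have hcN := hcons.tendsto_lintegral_measure h.measurable_train hμ hμhat (half_pos hε)
  have hc2 : ENNReal.ofReal (c / 2) ≠ 0 := by simpa using hc
  -- The first `a` calibration points are dropped. Half of `ε`, and half of the gap `c` that it
  -- leaves, pay for the regression error; half of the rest of the gap pays for the dropped points.
  have hbound : ∀ a : ℕ, ∀ᶠ p : ℕ × ℕ in atTop ×ˢ atTop,
      Pr {ω | ENNReal.ofReal ε <
        (conformalQuantile α (μhat p.2 (D p.2 ω)) (past (Z p.2) p.1 ω) - (q : EReal)).abs}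
      ≤ 2 * ENNReal.ofReal (b (a + 1)) + (2 * ENNReal.ofReal (deviationBound b (a + 1) (c / 4)
          (p.1 - a)) + (∫⁻ ω, G p.2 ω ∂Pr) / ENNReal.ofReal (c / 2)) := by
    intro a
    have hlarge : ∀ᶠ n : ℕ in atTop, (a : ℝ) + 1 ≤ c / 4 * ((n - a : ℕ) : ℝ) :=
      ((tendsto_natCast_atTop_atTop.comp (tendsto_sub_atTop_nat a)).const_mul_atTop
        (by positivity)).eventually_ge_atTop _
    filter_upwards [tendsto_fst.eventually hlarge,
      tendsto_fst.eventually (eventually_ge_atTop (a + 1)),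
      tendsto_snd.eventually (eventually_ge_atTop 1)] with ⟨n, N⟩ hn hna hN
    obtain ⟨m, rfl⟩ := Nat.exists_eq_add_of_le (show a ≤ n by simp at hna; omega)
    simp only [Nat.add_sub_cancel_left] at hn hna hN ⊢
    set R : ℝ → Set ((Fin N → X × ℝ) × (X × ℝ)) := fun t =>
      {r | |r.2.2 - μhat N r.1 r.2.1| ≤ t} with hRdef
    have hR : ∀ t, MeasurableSet (R t) := fun t =>
      measurableSet_le (measurable_snd.snd.sub ((hμhat N).comp
        (measurable_fst.prodMk measurable_snd.fst))).abs measurable_const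
    set E : ℝ → Set Ω := fun t => {ω | c / 4 * m ≤
      |∑ k ∈ Finset.range m, {z | (D N ω, z) ∈ R t}.indicator 1 (Z N (a + 1 + k) ω)
        - m * π.real {z | (D N ω, z) ∈ R t}|} with hE
    have hGm : Measurable (G N) := by
      refine measurable_measure_prodMk_left (ν := π) (s := {p : Ω × (X × ℝ) |
        ε / 2 < |μhat N (D N p.1) p.2.1 - μ p.2.1|}) ?_
      exact measurableSet_lt measurable_const (((hμhat N).comp
        (((h.measurable_train N).comp measurable_fst).prodMk measurable_snd.fst)).sub
          (hμ.comp measurable_snd.fst)).abs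
    have hsub : {ω | ENNReal.ofReal ε < (conformalQuantile α (μhat N (D N ω))
          (past (Z N) (a + m) ω) - (q : EReal)).abs}
        ⊆ (E (q + ε) ∪ E (q - ε)) ∪ {ω | ENNReal.ofReal (c / 2) ≤ G N ω} := by
      intro ω hω
      by_cases hbad : ENNReal.ofReal (c / 2) ≤ G N ω
      · exact Or.inr hbad
      left
      have hgood : π.real {z | ε / 2 < |μhat N (D N ω) z.1 - μ z.1|} ≤ c / 2 :=
        ENNReal.toReal_le_of_le_ofReal (by positivity) (not_le.1 hbad).le
      have hgood' : π.real {z | ε / 2 < |μ z.1 - μhat N (D N ω) z.1|} ≤ c / 2 := by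
        simpa only [abs_sub_comm] using hgood
      have h1 := measureReal_abs_sub_le π μ (μhat N (D N ω)) (q + ε / 2) (ε / 2)
      have h2 := measureReal_abs_sub_le π (μhat N (D N ω)) μ (q - ε) (ε / 2)
      rw [show q + ε / 2 + ε / 2 = q + ε by ring] at h1
      rw [show q - ε + ε / 2 = q - ε / 2 by ring] at h2
      obtain ⟨t, ht, hdev⟩ := deviation_of_lt_empQuantile_sub
        (s := fun i => |(Z N (i + 1) ω).2 - μhat N (D N ω) (Z N (i + 1) ω).1|)
        (P := fun t => π.real {z | |z.2 - μhat N (D N ω) z.1| ≤ t})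
        hα₀ hα₁ hn (by linarith) (by linarith) hω
      have : ω ∈ E t := by
        simp only [hE, Set.mem_ofPred_eq, hRdef]
        convert hdev using 6 with k
        rw [add_right_comm]
        rfl
      rcases ht with rfl | rfl
      · exact Or.inl this
      · exact Or.inr this
    have hdev : ∀ t, Pr (E t) ≤ ENNReal.ofReal (b (a + 1))
        + ENNReal.ofReal (deviationBound b (a + 1) (c / 4) m) := fun t =>
      h.measure_frequency_deviation_le hN (Nat.le_add_left 1 a) (hR t) (by positivity) (by omega)
    refine (measure_mono hsub).trans ((measure_union_le _ _).trans ?_)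
    rw [← add_assoc]
    refine add_le_add ((measure_union_le _ _).trans ((add_le_add (hdev _) (hdev _)).trans ?_))
      (meas_ge_le_lintegral_div hGm.aemeasurable hc2 ENNReal.ofReal_ne_top)
    rw [← two_mul, mul_add]
  rw [ENNReal.tendsto_nhds_zero]
  intro η hη
  have hη2 : 0 < η / 2 := ENNReal.half_pos hη.ne'
  have hb : Tendsto (fun a => 2 * ENNReal.ofReal (b (a + 1))) atTop (𝓝 0) := by
    have := ENNReal.Tendsto.const_mul (a := 2)
      (ENNReal.tendsto_ofReal (h.tendsto.comp (tendsto_add_atTop_nat 1))) (Or.inr (by simp))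
    simpa using this
  obtain ⟨a, ha⟩ := ((ENNReal.tendsto_nhds_zero.1 hb) _ hη2).exists
  have hrest : Tendsto (fun p : ℕ × ℕ => 2 * ENNReal.ofReal (deviationBound b (a + 1) (c / 4)
      (p.1 - a)) + (∫⁻ ω, G p.2 ω ∂Pr) / ENNReal.ofReal (c / 2)) (atTop ×ˢ atTop) (𝓝 0) := by
    have h1 := ENNReal.Tendsto.const_mul (a := 2) (ENNReal.tendsto_ofReal
      ((tendsto_deviationBound h.tendsto (a + 1) (c / 4)).comp (tendsto_sub_atTop_nat a)))
      (Or.inr (by simp))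
    have h2 := ENNReal.Tendsto.div_const hcN (Or.inr hc2)
    simp only [ENNReal.ofReal_zero, mul_zero, ENNReal.zero_div] at h1 h2
    simpa using (h1.comp tendsto_fst).add (h2.comp tendsto_snd)
  filter_upwards [hbound a, (ENNReal.tendsto_nhds_zero.1 hrest) _ hη2] with p h1 h2
  exact h1.trans ((add_le_add ha h2).trans_eq (ENNReal.add_halves η))

theorem Decouples.asymptoticallyEfficient (h : Decouples Pr D Z π b) (hμ : Measurable μ)
    (hμhat : ∀ N, Measurable fun p : (Fin N → X × ℝ) × X => μhat N p.1 p.2)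
    (hcons : Consistent Pr π D μhat μ) {α : ℝ} (hα₀ : 0 < α) (hα₁ : α < 1)
    (hdens : HasDensityBoundedBelowNear (residualLaw π μ) (quantile (residualLaw π μ) (1 - α))) :
    AsymptoticallyEfficient Pr D Z μhat μ α (quantile (residualLaw π μ) (1 - α)) := by
  intro ε hε
  have hq := fun {ε : ℝ} (hε : 0 < ε) =>
    tendsto_measure_quantile_error h hμ hμhat hcons hα₀ hα₁ hdens hε
  have hm := fun {ε : ℝ} (hε : 0 < ε) => tendsto_measure_regression_error h hμ hμhat hcons hε
  refine ⟨vanishesInAnyOrder_of_tendsto (hq hε), vanishesInAnyOrder_of_tendsto (hm hε),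
    vanishesInAnyOrder_of_tendsto ?_⟩
  have hε8 : 0 < ε / 8 := by positivity
  have hlim := (hq hε8).add (hm hε8)
  rw [add_zero] at hlim
  refine tendsto_of_tendsto_of_tendsto_of_le_of_le tendsto_const_nhds hlim
    (fun _ => zero_le) fun p => ?_
  refine (measure_mono fun ω hω => ?_).trans (measure_union_le _ _)
  by_contra hnot
  rw [Set.mem_union, not_or] at hnot
  have hvol := volume_symmDiff_interval_le (not_lt.1 hnot.2) (not_lt.1 hnot.1)
  rw [mul_div_cancel₀ ε (by norm_num)] at hvol
  exact hvol.not_gt hω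

end Efficiency

/-! ### Markov chains -/

section Chain

variable {Ω S : Type*} [MeasurableSpace Ω] [MeasurableSpace S] {Pr : Measure Ω}
  {W : ℕ → Ω → S} {K : Kernel S S} {ν π : Measure S}

/-- The rate at which a `β`-mixing chain that converges to `π` forgets its past: the sum of the
`β`-mixing coefficient and of the largest distance to `π` from some time on. -/
noncomputable def mixingRate (Pr : Measure Ω) (W : ℕ → Ω → S) (π : Measure S) (a : ℕ) : ℝ :=
  (betaCoeff Pr W a).toReal + (⨆ k, tv (Pr.map (W (a + k))) π).toReal + if a = 0 then 1 else 0

theorem betaCoeff_le_mixingRate (a : ℕ) : (betaCoeff Pr W a).toReal ≤ mixingRate Pr W π a := by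
  have : (0 : ℝ) ≤ if a = 0 then 1 else 0 := by split_ifs <;> norm_num
  have := (⨆ k, tv (Pr.map (W (a + k))) π).toReal_nonneg
  unfold mixingRate
  linarith

theorem iSup_tv_le_mixingRate (a : ℕ) :
    (⨆ k, tv (Pr.map (W (a + k))) π).toReal ≤ mixingRate Pr W π a := by
  have : (0 : ℝ) ≤ if a = 0 then 1 else 0 := by split_ifs <;> norm_num
  have := (betaCoeff Pr W a).toReal_nonneg
  unfold mixingRate
  linarith

theorem mixingRate_nonneg (a : ℕ) : 0 ≤ mixingRate Pr W π a :=
  ENNReal.toReal_nonneg.trans (betaCoeff_le_mixingRate a)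

theorem one_le_mixingRate_zero : 1 ≤ mixingRate Pr W π 0 := by
  simp only [mixingRate, if_true]
  exact le_add_of_nonneg_left (add_nonneg ENNReal.toReal_nonneg ENNReal.toReal_nonneg)

variable [IsProbabilityMeasure Pr] [IsMarkovKernel K]

theorem IsMarkovChain.map_eq (h : IsMarkovChain Pr W K ν) (k : ℕ) :
    Pr.map (W k) = (K ^ k) ∘ₘ ν := by
  induction k with
  | zero => rw [h.map_zero, pow_zero]; exact Measure.id_comp.symm
  | succ k ih =>
    rw [pow_succ', show ((K * K ^ k) ∘ₘ ν) = K ∘ₘ ((K ^ k) ∘ₘ ν) from Measure.comp_assoc.symm, ← ih]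
    ext A hA
    have hle : ⨆ i ≤ k, MeasurableSpace.comap (W i) inferInstance ≤ ‹MeasurableSpace Ω› :=
      iSup₂_le fun i _ => (h.measurable i).comap_le
    have h1 := integral_congr_ae (h.condProb_succ k A hA)
    rw [integral_condExp hle] at h1
    rw [integral_indicator (h.measurable (k + 1) hA)] at h1
    simp only [integral_const, smul_eq_mul, mul_one, measureReal_restrict_apply_univ] at h1
    rw [Measure.map_apply (h.measurable _) hA, Measure.bind_apply hA (Kernel.aemeasurable _),
      lintegral_map (K.measurable_coe hA) (h.measurable k)]
    rw [← ofReal_measureReal (μ := Pr), h1, ofReal_integral_eq_lintegral_ofReal]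
    · exact lintegral_congr fun ω => ofReal_measureReal
    · refine Integrable.of_bound
        ((K.measurable_coe hA).ennreal_toReal.comp (h.measurable k)).aestronglyMeasurable 1
        (ae_of_all _ fun ω => ?_)
      rw [Real.norm_of_nonneg measureReal_nonneg]
      exact measureReal_le_one
    · exact ae_of_all _ fun ω => measureReal_nonneg

theorem IsMarkovChain.tendsto_mixingRate (h : IsMarkovChain Pr W K ν)
    (hconv : ConvergesInTV K ν π) (hβ : IsBetaMixing Pr W) :
    Tendsto (mixingRate Pr W π) atTop (𝓝 0) := by
  have h1 : Tendsto (fun a => (betaCoeff Pr W a).toReal) atTop (𝓝 0) :=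
    (ENNReal.tendsto_toReal ENNReal.zero_ne_top).comp hβ
  have h2 : Tendsto (fun a => ⨆ k, tv (Pr.map (W (a + k))) π) atTop (𝓝 0) := by
    simp_rw [h.map_eq]
    rw [ENNReal.tendsto_nhds_zero]
    intro ε hε
    obtain ⟨a₀, ha₀⟩ := eventually_atTop.1 (ENNReal.tendsto_nhds_zero.1 hconv ε hε)
    filter_upwards [eventually_ge_atTop a₀] with a ha
    exact iSup_le fun k => ha₀ _ (ha.trans (Nat.le_add_right a k))
  have h3 : Tendsto (fun a : ℕ => if a = 0 then (1 : ℝ) else 0) atTop (𝓝 0) :=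
    tendsto_const_nhds.congr' ((eventually_ne_atTop 0).mono fun a ha => (if_neg ha).symm)
  have h4 := (h1.add ((ENNReal.tendsto_toReal ENNReal.zero_ne_top).comp h2)).add h3
  simp only [ENNReal.toReal_zero, add_zero] at h4
  exact h4

variable [IsProbabilityMeasure π]

theorem betaCoeff_le_one (hW : ∀ k, Measurable (W k)) (a : ℕ) : betaCoeff Pr W a ≤ 1 := by
  refine iSup₂_le fun t _ => ?_
  have := Measure.isProbabilityMeasure_map (μ := Pr) (measurable_past hW t).aemeasurable
  have := Measure.isProbabilityMeasure_map (μ := Pr) (measurable_future hW (t + a)).aemeasurable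
  have := Measure.isProbabilityMeasure_map (μ := Pr)
    ((measurable_past hW t).prodMk (measurable_future hW (t + a))).aemeasurable
  exact tv_le_one _ _

theorem abs_past_future_sub_le_betaCoeff (hW : ∀ k, Measurable (W k)) {t : ℕ} (ht : 1 ≤ t) (a : ℕ)
    {E : Set ((Fin t → S) × (ℕ → S))} (hE : MeasurableSet E) :
    |(Pr.map fun ω => (past W t ω, future W (t + a) ω)).real E
      - ((Pr.map (past W t)).prod (Pr.map (future W (t + a)))).real E|
      ≤ (betaCoeff Pr W a).toReal :=
  abs_measureReal_sub_le_of_tv_le (ne_top_of_le_ne_top ENNReal.one_ne_top (betaCoeff_le_one hW a))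
    (le_iSup₂ (f := fun t (_ : 1 ≤ t) => tv (Pr.map fun ω => (past W t ω, future W (t + a) ω))
      ((Pr.map (past W t)).prod (Pr.map (future W (t + a))))) t ht) hE

theorem abs_pair_sub_le_betaCoeff (hW : ∀ k, Measurable (W k)) {i j : ℕ} (hi : 1 ≤ i) (hij : i < j)
    {A : Set S} (hA : MeasurableSet A) :
    |Pr.real (W i ⁻¹' A ∩ W j ⁻¹' A) - Pr.real (W i ⁻¹' A) * Pr.real (W j ⁻¹' A)|
      ≤ (betaCoeff Pr W (j - i)).toReal := by
  have hp := measurable_past hW i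
  have hf := measurable_future hW (i + (j - i))
  have hA₁ : MeasurableSet {x : Fin i → S | x ⟨i - 1, by omega⟩ ∈ A} := measurable_pi_apply _ hA
  have hA₂ : MeasurableSet {x : ℕ → S | x 0 ∈ A} := measurable_pi_apply _ hA
  have hp' : past W i ⁻¹' {x : Fin i → S | x ⟨i - 1, by omega⟩ ∈ A} = W i ⁻¹' A := by
    ext ω; simp [past, Nat.sub_add_cancel hi]
  have hf' : future W (i + (j - i)) ⁻¹' {x : ℕ → S | x 0 ∈ A} = W j ⁻¹' A := by
    ext ω; simp [future, Nat.add_sub_cancel' hij.le]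
  have h := abs_past_future_sub_le_betaCoeff (Pr := Pr) hW hi (j - i) (hA₁.prod hA₂)
  rwa [map_measureReal_apply (hp.prodMk hf) (hA₁.prod hA₂), measureReal_prod_prod,
    map_measureReal_apply hp hA₁, map_measureReal_apply hf hA₂, Set.mk_preimage_prod, hp', hf'] at h

theorem abs_marginal_sub_le (hW : ∀ k, Measurable (W k)) (a k : ℕ) {A : Set S}
    (hA : MeasurableSet A) :
    |Pr.real (W (a + k) ⁻¹' A) - π.real A| ≤ (⨆ k, tv (Pr.map (W (a + k))) π).toReal := by
  have hle : ⨆ k, tv (Pr.map (W (a + k))) π ≤ 1 := iSup_le fun k =>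
    have := Measure.isProbabilityMeasure_map (μ := Pr) (hW (a + k)).aemeasurable
    tv_le_one _ _
  rw [← map_measureReal_apply (hW _) hA]
  exact abs_measureReal_sub_le_of_tv_le (ne_top_of_le_ne_top ENNReal.one_ne_top hle)
    (le_iSup (fun k => tv (Pr.map (W (a + k))) π) k) hA

/-- The case where calibration and test data continue the training chain. -/
theorem IsMarkovChain.decouples (h : IsMarkovChain Pr W K ν)
    (hconv : ConvergesInTV K ν π) (hβ : IsBetaMixing Pr W) :
    Decouples Pr (fun N => past W N) (fun N i => W (N + i)) π (mixingRate Pr W π) where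
  measurable_train N := measurable_past h.measurable N
  measurable N i := h.measurable _
  nonneg := mixingRate_nonneg
  one_le := one_le_mixingRate_zero
  tendsto := h.tendsto_mixingRate hconv hβ
  joint N a hN _ E hE := by
    have hfut : future (fun i => W (N + i)) a = future W (N + a) := by
      funext ω k; simp only [future, add_assoc]
    rw [hfut]
    exact (abs_past_future_sub_le_betaCoeff h.measurable hN a hE).trans (betaCoeff_le_mixingRate a)
  pair N i j hi hij A hA := by
    have := abs_pair_sub_le_betaCoeff (Pr := Pr) h.measurable (show 1 ≤ N + i by omega)
      (show N + i < N + j by omega) hA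
    rw [Nat.add_sub_add_left] at this
    exact this.trans (betaCoeff_le_mixingRate _)
  marginal N i A hA := by
    rw [add_comm N i]
    exact (abs_marginal_sub_le h.measurable i N hA).trans (iSup_tv_le_mixingRate i)

/-- The case where calibration and test data come from a second chain `W'`, independent of the
process `W` that provides the training data. -/
theorem IsMarkovChain.decouples_of_indepFun {W' : ℕ → Ω → S} (h : IsMarkovChain Pr W' K ν)
    (hW : ∀ k, Measurable (W k)) (hindep : IndepFun (fun ω k => W k ω) (fun ω k => W' k ω) Pr)
    (hconv : ConvergesInTV K ν π) (hβ : IsBetaMixing Pr W') :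
    Decouples Pr (fun N => past W N) (fun _ i => W' i) π (mixingRate Pr W' π) where
  measurable_train N := measurable_past hW N
  measurable _ i := h.measurable i
  nonneg := mixingRate_nonneg
  one_le := one_le_mixingRate_zero
  tendsto := h.tendsto_mixingRate hconv hβ
  joint N a _ _ E _ := by
    have hind : IndepFun (past W N) (future W' a) Pr :=
      hindep.comp (φ := fun (w : ℕ → S) (i : Fin N) => w (i + 1))
        (ψ := fun (w : ℕ → S) (k : ℕ) => w (a + k)) (by fun_prop) (by fun_prop)
    rw [(indepFun_iff_map_prod_eq_prod_map_map (measurable_past hW N).aemeasurable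
      (measurable_future h.measurable a).aemeasurable).1 hind, sub_self, abs_zero]
    exact mixingRate_nonneg a
  pair _ i j hi hij A hA :=
    (abs_pair_sub_le_betaCoeff h.measurable hi hij hA).trans (betaCoeff_le_mixingRate _)
  marginal _ i A hA :=
    (abs_marginal_sub_le h.measurable i 0 hA).trans (iSup_tv_le_mixingRate i)

end Chain

end ConformalMarkov

open ConformalMarkov in
theorem mainTheorem3 {Ω X : Type*} [MeasurableSpace Ω] [MeasurableSpace X]
    (Pr : Measure Ω) [IsProbabilityMeasure Pr]
    -- the chain of pairs `(X, Y)`: kernel, stationary law, initial law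
    (K : Kernel (X × ℝ) (X × ℝ)) [IsMarkovKernel K]
    (π : Measure (X × ℝ)) [IsProbabilityMeasure π] (hπ : K.Invariant π)
    (ν₀ : Measure (X × ℝ)) [IsProbabilityMeasure ν₀]
    (W : ℕ → Ω → X × ℝ) (hW : IsMarkovChain Pr W K ν₀)
    -- the level, the regression function, and the oracle quantile
    (α : ℝ) (hα₀ : 0 < α) (hα₁ : α < 1)
    (μ : X → ℝ) (hμ : Measurable μ)
    (hdens : HasDensityBoundedBelowNear (residualLaw π μ) (quantile (residualLaw π μ) (1 - α)))
    -- the learning algorithm, trained on the first `N` observations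
    (μhat : (N : ℕ) → (Fin N → X × ℝ) → X → ℝ)
    (hμhat : ∀ N, Measurable fun p : (Fin N → X × ℝ) × X => μhat N p.1 p.2)
    (hcons : Consistent Pr π (fun N => past W N) μhat μ) :
    -- calibration and test data continue the training chain
    (ConvergesInTV K ν₀ π → IsBetaMixing Pr W →
      AsymptoticallyEfficient Pr (fun N => past W N) (fun N i => W (N + i)) μhat μ α
        (quantile (residualLaw π μ) (1 - α))) ∧
    -- the chain is restarted independently of the training data, with initial law `ν₁`
    (∀ (ν₁ : Measure (X × ℝ)) (W' : ℕ → Ω → X × ℝ), IsProbabilityMeasure ν₁ →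
      IsMarkovChain Pr W' K ν₁ → IndepFun (fun ω k => W k ω) (fun ω k => W' k ω) Pr →
      ConvergesInTV K ν₁ π → IsBetaMixing Pr W' →
      AsymptoticallyEfficient Pr (fun N => past W N) (fun _ i => W' i) μhat μ α
        (quantile (residualLaw π μ) (1 - α))) := by
  refine ⟨fun hconv hβ => ?_, fun ν₁ W' _ hW' hindep hconv hβ => ?_⟩
  · exact (hW.decouples hconv hβ).asymptoticallyEfficient hμ hμhat hcons hα₀ hα₁ hdens
  · exact (hW'.decouples_of_indepFun hW.measurable hindep hconv hβ).asymptoticallyEfficient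
      hμ hμhat hcons hα₀ hα₁ hdens
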